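/- Let $M\ge 0$ be an integer, $\gamma\in\mathbb R$ and $s>0$. On the $M$-mode Hilbert space $L^2(\mathbb R^M)$ let $\hat x_k$ (multiplication by $x_k$) and $\hat p_k=-i\,\partial_{x_k}$, $k=1,\dots,M$, be the quadratures, so $[\hat x_k,\hat p_l]=i\delta_{kl}$. Let $|\gamma\rangle_s$ be the finitely squeezed cubic phase state, i.e. the single-mode state with wave function $$\frac{e^{i\gamma x^3}\,e^{-x^2/(2s^2)}}{\sqrt s\,\pi^{1/4}},$$ and let $\sigma=(|\gamma\rangle_s\langle\gamma|_s)^{\otimes M}$. For a density operator $\rho$ write $F(\sigma,\rho)=\operatorname{Tr}(\sigma\rho)$. Define, on Schwartz space, $$\mathcal W=\Bigl(1+\frac M2\Bigr)\mathbb 1-\sum_{k=1}^{M}w_k,$$ $$w_k=\frac1{2s^2}\hat x_k^2+\frac{s^2}{2}\bigl(9\gamma^2\hat x_k^4+\hat p_k^2+2\gamma\hat p_k^3\bigr)+\frac{s^2}{2}\gamma\bigl((\hat x_k-\hat p_k)^3-(\hat x_k+\hat p_k)^3\bigr).$$ Then $\sigma$ is a density operator and $\mathcal W$ is a fidelity witness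 for $\sigma$: $\mathcal W$ is Hermitian (symmetric on Schwartz space); $\operatorname{Tr}(\mathcal W\rho)\le F(\sigma,\rho)$ for every density operator $\rho$ on $L^2(\mathbb R^M)$; and $\operatorname{Tr}(\mathcal W\sigma)=1=F(\sigma,\sigma)$. Here $\operatorname{Tr}(\mathcal W\rho)=\sum_i q(\rho^{1/2}e_i)\in[-\infty,\infty)$ for any orthonormal basis $(e_i)$, where $q$ is the closed quadratic form of $\mathcal W$ (the upper semicontinuous extension to $L^2(\mathbb R^M)$ of $\eta\mapsto\langle\eta,\mathcal W\eta\rangle$, $\eta$ Schwartz, equal to $-\infty$ off the form domain). Moreover $\mathcal W$ is accessible by homodyne detection alone: it is a real linear combination of $\mathbb 1$ and of at most $6M$ operators, each a power with exponent at most $4$ of a single-mode quadrature $\cos\theta\,\hat x_k+\sin\theta\,\hat p_k$, with at most four phases $\theta$ for each mode $k$. -/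

import Mathlib

open MeasureTheory Filter Topology
open scoped InnerProductSpace ENNReal SchwartzMap

noncomputable section

namespace CVWitness

/-- Configuration space of `M` modes. -/
abbrev Conf (M : ℕ) : Type := EuclideanSpace ℝ (Fin M)

/-- The Hilbert space `L²(ℝ^M)` of `M` modes (`M = 0` gives `ℂ`). -/
abbrev ModeSpace (M : ℕ) : Type := Lp ℂ 2 (volume : Measure (Conf M))

/-- Schwartz space: the common invariant domain of all polynomials in the quadratures. -/
abbrev TestSpace (M : ℕ) : Type := 𝓢(Conf M, ℂ)

/-- A (possibly unbounded) operator given on Schwartz space, leaving it invariant. The ring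
structure (sum, composition, powers) is that of endomorphisms. -/
abbrev Op (M : ℕ) : Type := TestSpace M →L[ℂ] TestSpace M

/-- A Schwartz function as a vector of the Hilbert space. -/
def ket {M : ℕ} (η : TestSpace M) : ModeSpace M := η.toLp 2 volume

/-! ### Quadratures -/

/-- Position operator of mode `k`: `(x̂_k η)(x) = x_k η(x)`. -/
def X {M : ℕ} (k : Fin M) : Op M :=
  SchwartzMap.smulLeftCLM ℂ (fun x : Conf M => ((x k : ℝ) : ℂ))

/-- Momentum operator of mode `k`: `p̂_k η = -i ∂_k η`. -/
def P {M : ℕ} (k : Fin M) : Op M :=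
  (-Complex.I) • LineDeriv.lineDerivOpCLM ℂ (TestSpace M) (EuclideanSpace.single k (1 : ℝ))

theorem X_apply {M : ℕ} (k : Fin M) (η : TestSpace M) (x : Conf M) :
    X k η x = ((x k : ℝ) : ℂ) * η x := by
  have h : (fun x : Conf M => ((x k : ℝ) : ℂ)).HasTemperateGrowth :=
    (Complex.ofRealCLM.comp (EuclideanSpace.proj k : Conf M →L[ℝ] ℝ)).hasTemperateGrowth
  simp [X, SchwartzMap.smulLeftCLM_apply_apply h]

theorem P_apply {M : ℕ} (k : Fin M) (η : TestSpace M) (x : Conf M) :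
    P k η x = -Complex.I * lineDeriv ℝ η x (EuclideanSpace.single k (1 : ℝ)) := by
  simp [P, SchwartzMap.lineDerivOp_apply]

/-- The quadrature of mode `k` at phase `θ`: the observable read out by homodyne detection of
mode `k` with local-oscillator phase `θ`. -/
def quadrature {M : ℕ} (k : Fin M) (θ : ℝ) : Op M :=
  (Real.cos θ : ℂ) • X k + (Real.sin θ : ℂ) • P k

/-! ### The target state -/

/-- Wave function of the finitely squeezed cubic phase state,
`e^{iγx³} e^{-x²/(2s²)} / (√s π^{1/4})`. -/
def cubicPhaseWave (γ s : ℝ) (x : ℝ) : ℂ :=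
  Complex.exp (Complex.I * γ * x ^ 3) * Complex.exp (-x ^ 2 / (2 * s ^ 2)) /
    ((√s * Real.pi ^ (1 / 4 : ℝ) : ℝ) : ℂ)

/-- Wave function of `M` independent copies. -/
def targetWave (γ s : ℝ) (M : ℕ) (x : Conf M) : ℂ := ∏ k, cubicPhaseWave γ s (x k)

theorem memLp_targetWave (γ : ℝ) {s : ℝ} (hs : 0 < s) (M : ℕ) :
    MemLp (targetWave γ s M) 2 (volume : Measure (Conf M)) := by
  have hcont : Continuous (targetWave γ s M) := by
    unfold targetWave cubicPhaseWave
    fun_prop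
  rw [memLp_two_iff_integrable_sq_norm hcont.aestronglyMeasurable]
  set A : ℝ := √s * Real.pi ^ (1 / 4 : ℝ) with hA
  have hb : 0 < (((1 / s ^ 2 : ℝ) : ℂ)).re := by
    rw [Complex.ofReal_re]; positivity
  have key := (GaussianFourier.integrable_cexp_neg_mul_sq_norm_add hb 0 (0 : Conf M)).norm
  have h1 : ∀ t : ℝ, ‖cubicPhaseWave γ s t‖ ^ 2 = (1 / ‖A‖ ^ 2) * Real.exp (-(t ^ 2 / s ^ 2)) := by
    intro t
    have e1 : ‖Complex.exp (Complex.I * γ * t ^ 3)‖ = 1 := by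
      have : Complex.I * γ * t ^ 3 = ((γ * t ^ 3 : ℝ) : ℂ) * Complex.I := by push_cast; ring
      rw [this, Complex.norm_exp_ofReal_mul_I]
    have e2 : ‖Complex.exp (-(t : ℂ) ^ 2 / (2 * s ^ 2))‖ = Real.exp (-t ^ 2 / (2 * s ^ 2)) := by
      have : (-(t : ℂ) ^ 2 / (2 * s ^ 2)) = ((-t ^ 2 / (2 * s ^ 2) : ℝ) : ℂ) := by push_cast; ring
      rw [this, Complex.norm_exp_ofReal]
    rw [cubicPhaseWave, norm_div, norm_mul, e1, e2, ← hA, Complex.norm_real, one_mul, div_pow,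
      ← Real.exp_nat_mul]
    rw [div_eq_mul_inv, mul_comm, one_div]
    congr 2
    field_simp
    push_cast
    ring
  have h2 : (fun x : Conf M => ‖targetWave γ s M x‖ ^ 2) =
      fun x => (1 / ‖A‖ ^ 2) ^ M *
        ‖Complex.exp (-((1 / s ^ 2 : ℝ) : ℂ) * (‖x‖ : ℂ) ^ 2 + 0 * ((inner ℝ 0 x : ℝ) : ℂ))‖ := by
    funext x
    rw [targetWave, norm_prod, ← Finset.prod_pow]
    simp_rw [h1]
    rw [Finset.prod_mul_distrib, Finset.prod_const, Finset.card_univ, Fintype.card_fin,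
      ← Real.exp_sum]
    congr 1
    have : -((1 / s ^ 2 : ℝ) : ℂ) * (‖x‖ : ℂ) ^ 2 + 0 * ((inner ℝ 0 x : ℝ) : ℂ) =
        ((-(1 / s ^ 2) * ‖x‖ ^ 2 : ℝ) : ℂ) := by push_cast; ring
    rw [this, Complex.norm_exp_ofReal, EuclideanSpace.norm_sq_eq, Finset.mul_sum]
    congr 1
    refine Finset.sum_congr rfl fun i _ => ?_
    rw [Real.norm_eq_abs, sq_abs]
    ring
  rw [h2]
  exact key.const_mul _

/-- The unit vector `|γ⟩_s^{⊗M}`. -/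
def targetVec (γ : ℝ) {s : ℝ} (hs : 0 < s) (M : ℕ) : ModeSpace M :=
  (memLp_targetWave γ hs M).toLp

/-- The target state `σ = (|γ⟩_s⟨γ|_s)^{⊗M}`. -/
def target (γ : ℝ) {s : ℝ} (hs : 0 < s) (M : ℕ) : ModeSpace M →L[ℂ] ModeSpace M :=
  InnerProductSpace.rankOne ℂ (targetVec γ hs M) (targetVec γ hs M)

/-! ### States, traces, fidelity

Traces are computed in an orthonormal basis `e`, over which the theorem quantifies. -/

/-- Density operator: positive, of trace one. -/
def IsDensityOperator {M : ℕ} {ι : Type*} (e : HilbertBasis ι ℂ (ModeSpace M))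
    (ρ : ModeSpace M →L[ℂ] ModeSpace M) : Prop :=
  ρ.IsPositive ∧ HasSum (fun i => ⟪e i, ρ (e i)⟫_ℂ) 1

/-- The (squared) fidelity `F(σ, ρ) = Tr(σρ)` with respect to a pure state `σ`. -/
def fidelity {M : ℕ} {ι : Type*} (e : HilbertBasis ι ℂ (ModeSpace M))
    (σ ρ : ModeSpace M →L[ℂ] ModeSpace M) : ℝ :=
  (∑' i, ⟪e i, σ (ρ (e i))⟫_ℂ).re

/-! ### Expectation values of an unbounded observable -/

/-- `⟨φ, W φ⟩ ∈ [-∞, ∞]` for an arbitrary vector `φ`: the form `η ↦ ⟨η, W η⟩` on Schwartz space,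
extended to all of `L²` by upper semicontinuity. For `W` symmetric and bounded above this is the
closed quadratic form of `W`, with value `-∞` off the form domain. -/
def formValue {M : ℕ} (W : Op M) (φ : ModeSpace M) : EReal :=
  limsup (fun η : TestSpace M => (((⟪ket η, ket (W η)⟫_ℂ).re : ℝ) : EReal)) (comap ket (𝓝 φ))

/-- The positive square root `ρ^{1/2}` of a positive bounded operator. -/
def opSqrt {H : Type*} [NormedAddCommGroup H] [InnerProductSpace ℂ H] [CompleteSpace H]
    (ρ : H →L[ℂ] H) : H →L[ℂ] H :=
  CFC.sqrt ρ

/-- `Tr(Wρ) = Tr(ρ^{1/2} W ρ^{1/2}) = ∑ᵢ ⟨ρ^{1/2}eᵢ, W ρ^{1/2}eᵢ⟩ ∈ [-∞, ∞]`, as the difference of the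
sums of the positive and of the negative parts. -/
def expectation {M : ℕ} {ι : Type*} (e : HilbertBasis ι ℂ (ModeSpace M))
    (W : Op M) (ρ : ModeSpace M →L[ℂ] ModeSpace M) : EReal :=
  ((∑' i, (formValue W (opSqrt ρ (e i))).toENNReal : ℝ≥0∞) : EReal) -
    ((∑' i, (-formValue W (opSqrt ρ (e i))).toENNReal : ℝ≥0∞) : EReal)

/-- Hermitian (symmetric) on Schwartz space. -/
def IsHermitianObservable {M : ℕ} (W : Op M) : Prop :=
  ∀ η ζ : TestSpace M, ⟪ket (W η), ket ζ⟫_ℂ = ⟪ket η, ket (W ζ)⟫_ℂ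

/-- `W` is a fidelity witness for the pure state `σ`: a Hermitian observable with
`Tr(Wρ) ≤ F(σ, ρ)` for all states `ρ`, and `Tr(Wσ) = 1`. -/
structure IsFidelityWitness {M : ℕ} {ι : Type*} (e : HilbertBasis ι ℂ (ModeSpace M))
    (σ : ModeSpace M →L[ℂ] ModeSpace M) (W : Op M) : Prop where
  hermitian : IsHermitianObservable W
  lower_bound : ∀ ρ : ModeSpace M →L[ℂ] ModeSpace M, IsDensityOperator e ρ →
    expectation e W ρ ≤ ((fidelity e σ ρ : ℝ) : EReal)
  tight : expectation e W σ = 1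

/-! ### The witness -/

/-- `w_k`, a polynomial of degree four in `x̂_k` and `p̂_k`. -/
def w (γ s : ℝ) {M : ℕ} (k : Fin M) : Op M :=
  ((1 / (2 * s ^ 2) : ℝ) : ℂ) • X k ^ 2
    + ((s ^ 2 / 2 : ℝ) : ℂ) • ((9 * γ ^ 2 : ℂ) • X k ^ 4 + P k ^ 2 + (2 * γ : ℂ) • P k ^ 3)
    + ((s ^ 2 / 2 * γ : ℝ) : ℂ) • ((X k - P k) ^ 3 - (X k + P k) ^ 3)

/-- `W = (1 + M/2) 𝟙 - ∑_k w_k`. -/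
def witness (γ s : ℝ) (M : ℕ) : Op M :=
  (1 + (M : ℂ) / 2) • (1 : Op M) - ∑ k, w γ s k

/-- `W` is accessible by homodyne detection alone: it is a real linear combination of the identity
and of at most `N` powers, of exponent at most `d`, of single-mode quadratures, with at most `b`
local-oscillator phases used on each mode. -/
def HomodyneMeasurable {M : ℕ} (N d b : ℕ) (W : Op M) : Prop :=
  ∃ (n : ℕ) (c : ℝ) (lam : Fin n → ℝ) (mode : Fin n → Fin M) (phase : Fin n → ℝ)
    (deg : Fin n → ℕ),
    n ≤ N ∧ (∀ i, deg i ≤ d) ∧ (∀ k, {θ | ∃ i, mode i = k ∧ phase i = θ}.ncard ≤ b) ∧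
    W = (c : ℂ) • (1 : Op M) + ∑ i, (lam i : ℂ) • quadrature (mode i) (phase i) ^ deg i

end CVWitness

end

/-!
The witness is `1 - N`, where `N = ∑ₖ aₖ† aₖ` is the number operator of the ladder operators
`aₖ = (xₖ / s + i s (pₖ - 3 γ xₖ²)) / √2`: these are the harmonic oscillator ones conjugated by the
cubic phase, and they annihilate the target `ψ`. Because `ψ` decays faster than every exponential,
Fourier uniqueness shows that the products of polynomials with `ψ` are dense in `L²`. Each of them
is a finite combination of excitations of `ψ`, so `L²` is the Hilbert sum of eigenspaces of `N` for
the eigenvalues `n ∈ ℕ`, the lowest one being `ℂ ψ`. Parseval then gives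
`‖η‖² - ⟨η, N η⟩ = ∑ₙ (1 - n) ‖Pₙ η‖² ≤ |⟨ψ, η⟩|²`, with equality at `η = ψ`. The bound passes to
the closed form by upper semicontinuity, and to density operators by summing over `√ρ eᵢ`.
-/

namespace CVWitness

open scoped ContDiff FourierTransform

section NumberOperator

variable {𝕜 H : Type*} [RCLike 𝕜] [NormedAddCommGroup H] [InnerProductSpace 𝕜 H]

theorem hasSum_inner_starProjection {ι : Type*} [CompleteSpace H] {E : ι → Submodule 𝕜 H}
    [∀ i, CompleteSpace (E i)]
    (hE : OrthogonalFamily 𝕜 (fun i => E i) fun i => (E i).subtypeₗᵢ)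
    (htop : ⊤ ≤ (⨆ i, E i).topologicalClosure) (x y : H) :
    HasSum (fun i => ⟪(E i).starProjection x, (E i).starProjection y⟫_𝕜) ⟪x, y⟫_𝕜 := by
  have hsum := IsHilbertSum.mkInternal (F := E) hE htop
  let U := hsum.linearIsometryEquiv
  have hU (z : H) (i : ι) : (E i).starProjection z = U z i := by
    have hz : HasSum (fun j => (E i).starProjection (U z j : H)) ((E i).starProjection z) := by
      have h := (hsum.hasSum_linearIsometryEquiv_symm (U z)).mapL (E i).starProjection
      rwa [LinearIsometryEquiv.symm_apply_apply] at h
    refine hz.unique ?_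
    convert hasSum_single i fun j hj => ?_ using 1
    · exact ((E i).starProjection_eq_self_iff.2 (U z i).2).symm
    · exact (Submodule.starProjection_apply_eq_zero_iff _).2
        fun u hu => hE hj.symm ⟨u, hu⟩ (U z j)
  simp only [hU]
  simpa only [LinearIsometryEquiv.inner_map_map, Submodule.coe_inner] using
    lp.hasSum_inner (𝕜 := 𝕜) (U x) (U y)

variable {D : Type*} [AddCommGroup D] [Module 𝕜 D] {ket : D →ₗ[𝕜] H} {T : Module.End 𝕜 D}

theorem inner_eq_zero_of_apply_eq_natCast_smul
    (hT : ∀ v w, ⟪ket (T v), ket w⟫_𝕜 = ⟪ket v, ket (T w)⟫_𝕜) {m n : ℕ} (hmn : m ≠ n) {v w : D}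
    (hv : T v = (m : 𝕜) • v) (hw : T w = (n : 𝕜) • w) : ⟪ket v, ket w⟫_𝕜 = 0 := by
  have h := hT v w
  rw [hv, hw, map_smul, map_smul, inner_smul_left, inner_smul_right, map_natCast] at h
  exact (mul_eq_mul_right_iff.1 h).resolve_left (Nat.cast_injective.ne hmn)

theorem starProjection_map_of_apply_eq_natCast_smul
    (hT : ∀ v w, ⟪ket (T v), ket w⟫_𝕜 = ⟪ket v, ket (T w)⟫_𝕜) {L : Submodule 𝕜 D}
    [(L.map ket).HasOrthogonalProjection] {n : ℕ} (hL : ∀ v ∈ L, T v = (n : 𝕜) • v) (η : D) :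
    (L.map ket).starProjection (ket (T η)) = (n : 𝕜) • (L.map ket).starProjection (ket η) := by
  rw [← map_smul, ← sub_eq_zero, ← map_sub, Submodule.starProjection_apply_eq_zero_iff]
  rintro _ ⟨v, hv, rfl⟩
  rw [inner_sub_right, ← hT, hL v hv, map_smul, inner_smul_left, inner_smul_right,
    map_natCast, sub_self]

theorem norm_sq_le_of_eigenspaces [CompleteSpace H]
    (hT : ∀ v w, ⟪ket (T v), ket w⟫_𝕜 = ⟪ket v, ket (T w)⟫_𝕜) {L : ℕ → Submodule 𝕜 D}
    [∀ n, Module.Finite 𝕜 (L n)] (hL : ∀ n, ∀ v ∈ L n, T v = (n : 𝕜) • v)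
    (htop : ⊤ ≤ ((⨆ n, L n).map ket).topologicalClosure) (η : D) :
    ‖ket η‖ ^ 2 ≤
      ‖((L 0).map ket).starProjection (ket η)‖ ^ 2 + RCLike.re ⟪ket η, ket (T η)⟫_𝕜 := by
  have hE : OrthogonalFamily 𝕜 (fun n => (L n).map ket) fun n => ((L n).map ket).subtypeₗᵢ := by
    rintro m n hmn ⟨_, v, hv, rfl⟩ ⟨_, w, hw, rfl⟩
    exact inner_eq_zero_of_apply_eq_natCast_smul hT hmn (hL m v hv) (hL n w hw)
  rw [Submodule.map_iSup] at htop
  have parseval := hasSum_inner_starProjection hE htop (ket η)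
  have hnorm : HasSum (fun n => ‖((L n).map ket).starProjection (ket η)‖ ^ 2) (‖ket η‖ ^ 2) := by
    simpa only [inner_self_eq_norm_sq] using RCLike.hasSum_re 𝕜 (parseval (ket η))
  have hnumber : HasSum (fun n : ℕ => n * ‖((L n).map ket).starProjection (ket η)‖ ^ 2)
      (RCLike.re ⟪ket η, ket (T η)⟫_𝕜) := by
    convert RCLike.hasSum_re 𝕜 (parseval (ket (T η))) using 2 with n
    rw [starProjection_map_of_apply_eq_natCast_smul hT (hL n), inner_smul_right,
      ← RCLike.ofReal_natCast (K := 𝕜) n, RCLike.re_ofReal_mul, inner_self_eq_norm_sq]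
  have hvacuum := hasSum_ite_eq 0 (‖((L 0).map ket).starProjection (ket η)‖ ^ 2)
  refine hasSum_le (fun n => ?_) hnorm (hvacuum.add hnumber)
  rcases n with _ | n
  · simp
  · rw [if_neg n.succ_ne_zero, zero_add]
    exact le_mul_of_one_le_left (sq_nonneg _) (by simp)

end NumberOperator

section Ladder

variable {ι R D : Type*} [CommRing R] [AddCommGroup D] [Module R D]
  {a b : ι → Module.End R D} {ψ : D}

/-- The span of the vectors obtained from the vacuum `ψ` by applying `n` of the raising
operators `b`. -/
def excitationLayer (b : ι → Module.End R D) (ψ : D) : ℕ → Submodule R D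
  | 0 => R ∙ ψ
  | n + 1 => ⨆ k, (excitationLayer b ψ n).map (b k)

/-- The number operator `∑ₖ bₖ aₖ` of the lowering operators `a` and the raising operators `b`. -/
def numberOp [Fintype ι] (a b : ι → Module.End R D) : Module.End R D := ∑ k, b k * a k

instance excitationLayer_finite [Finite ι] (n : ℕ) : Module.Finite R (excitationLayer b ψ n) := by
  induction n with
  | zero => rw [excitationLayer]; infer_instance
  | succ n ih => rw [excitationLayer]; infer_instance

theorem mem_iSup_excitationLayer_self : ψ ∈ ⨆ n, excitationLayer b ψ n :=
  Submodule.mem_iSup_of_mem 0 (Submodule.mem_span_singleton_self ψ)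

theorem raising_mem_iSup_excitationLayer (k : ι) {v : D} (hv : v ∈ ⨆ n, excitationLayer b ψ n) :
    b k v ∈ ⨆ n, excitationLayer b ψ n := by
  refine (Submodule.map_iSup (b k) _).trans_le (iSup_le fun n => ?_)
    (Submodule.mem_map_of_mem hv)
  exact (le_iSup (fun k => (excitationLayer b ψ n).map (b k)) k).trans
    (le_iSup (excitationLayer b ψ) (n + 1))

theorem lowering_mem_iSup_excitationLayer [DecidableEq ι]
    (hab : ∀ k l, ⁅a k, b l⁆ = if k = l then 1 else 0) (hψ : ∀ k, a k ψ = 0) (k : ι) {v : D}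
    (hv : v ∈ ⨆ n, excitationLayer b ψ n) : a k v ∈ ⨆ n, excitationLayer b ψ n := by
  suffices h : ∀ n, excitationLayer b ψ n ≤ (⨆ n, excitationLayer b ψ n).comap (a k) from
    iSup_le h hv
  intro n
  induction n with
  | zero => simp [excitationLayer, hψ, Submodule.span_singleton_le_iff_mem]
  | succ n ih =>
    refine iSup_le fun l => Submodule.map_le_iff_le_comap.2 fun v hv => ?_
    have hcomm : a k (b l v) = b l (a k v) + ⁅a k, b l⁆ v := by simp [Ring.lie_def]
    rw [Submodule.mem_comap, Submodule.mem_comap, hcomm, hab]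
    refine add_mem (raising_mem_iSup_excitationLayer l (ih hv)) ?_
    split_ifs
    · exact Submodule.mem_iSup_of_mem n hv
    · exact zero_mem _

theorem lie_numberOp_raising [Fintype ι] [DecidableEq ι]
    (hab : ∀ k l, ⁅a k, b l⁆ = if k = l then 1 else 0) (hbb : ∀ k l, Commute (b k) (b l))
    (l : ι) : ⁅numberOp a b, b l⁆ = b l := by
  calc ⁅numberOp a b, b l⁆ = ∑ k, b k * ⁅a k, b l⁆ := by
        rw [numberOp, Ring.lie_def, Finset.sum_mul, Finset.mul_sum, ← Finset.sum_sub_distrib]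
        refine Finset.sum_congr rfl fun k _ => ?_
        rw [Ring.lie_def, mul_sub, ← mul_assoc, ← mul_assoc, ← mul_assoc, (hbb k l).eq]
    _ = b l := by simp [hab]

theorem numberOp_apply_of_mem_excitationLayer [Fintype ι] [DecidableEq ι]
    (hab : ∀ k l, ⁅a k, b l⁆ = if k = l then 1 else 0) (hbb : ∀ k l, Commute (b k) (b l))
    (hψ : ∀ k, a k ψ = 0) (n : ℕ) :
    ∀ v ∈ excitationLayer b ψ n, numberOp a b v = (n : R) • v := by
  induction n with
  | zero =>
    intro v hv
    obtain ⟨c, rfl⟩ := Submodule.mem_span_singleton.1 hv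
    simp [numberOp, hψ]
  | succ n ih =>
    suffices h : excitationLayer b ψ (n + 1) ≤ (numberOp a b).eigenspace ((n + 1 : ℕ) : R) from
      fun v hv => Module.End.mem_eigenspace_iff.1 (h hv)
    refine iSup_le fun l => Submodule.map_le_iff_le_comap.2 fun v hv => ?_
    have hcomm : numberOp a b (b l v) = b l (numberOp a b v) + ⁅numberOp a b, b l⁆ v := by
      simp [Ring.lie_def]
    rw [Submodule.mem_comap, Module.End.mem_eigenspace_iff, hcomm,
      lie_numberOp_raising hab hbb, ih v hv, map_smul, Nat.cast_succ, add_smul, one_smul]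

end Ladder

section SpectralGap

variable {ι 𝕜 D H : Type*} [Fintype ι] [RCLike 𝕜] [AddCommGroup D] [Module 𝕜 D]
  [NormedAddCommGroup H] [InnerProductSpace 𝕜 H] {ket : D →ₗ[𝕜] H} {a b : ι → Module.End 𝕜 D}

theorem inner_numberOp_left (hadj : ∀ k v w, ⟪ket (a k v), ket w⟫_𝕜 = ⟪ket v, ket (b k w)⟫_𝕜)
    (v w : D) : ⟪ket (numberOp a b v), ket w⟫_𝕜 = ⟪ket v, ket (numberOp a b w)⟫_𝕜 := by
  have hadj' (k v w) : ⟪ket (b k v), ket w⟫_𝕜 = ⟪ket v, ket (a k w)⟫_𝕜 := by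
    rw [← inner_conj_symm, ← hadj, inner_conj_symm]
  simp only [numberOp, LinearMap.sum_apply, Module.End.mul_apply, map_sum, sum_inner, inner_sum,
    hadj', hadj]

theorem norm_sq_le_norm_inner_vacuum_sq_add_inner_numberOp [DecidableEq ι] [CompleteSpace H]
    (hadj : ∀ k v w, ⟪ket (a k v), ket w⟫_𝕜 = ⟪ket v, ket (b k w)⟫_𝕜)
    (hab : ∀ k l, ⁅a k, b l⁆ = if k = l then 1 else 0) (hbb : ∀ k l, Commute (b k) (b l))
    {ψ : D} (hψ : ∀ k, a k ψ = 0) (hnorm : ‖ket ψ‖ = 1)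
    (hcyc : ⊤ ≤ ((⨆ n, excitationLayer b ψ n).map ket).topologicalClosure) (η : D) :
    ‖ket η‖ ^ 2 ≤ ‖⟪ket ψ, ket η⟫_𝕜‖ ^ 2 + RCLike.re ⟪ket η, ket (numberOp a b η)⟫_𝕜 := by
  have hvacuum : (excitationLayer b ψ 0).map ket = 𝕜 ∙ ket ψ := by
    rw [excitationLayer, Submodule.map_span, Set.image_singleton]
  have hgap := norm_sq_le_of_eigenspaces (inner_numberOp_left hadj)
    (numberOp_apply_of_mem_excitationLayer hab hbb hψ) hcyc η
  simpa only [hvacuum, Submodule.starProjection_unit_singleton 𝕜 hnorm, norm_smul, hnorm,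
    mul_one] using hgap

end SpectralGap

section SchwartzDerivatives

variable {E F : Type*} [NormedAddCommGroup E] [NormedSpace ℝ E]

open LineDeriv

theorem lineDerivOp_comm [NormedAddCommGroup F] [NormedSpace ℝ F] (v w : E) (η : 𝓢(E, F)) :
    ∂_{v} (∂_{w} η) = ∂_{w} (∂_{v} η) := by
  have hsecond (v w x : E) : ∂_{v} (∂_{w} η) x = fderiv ℝ (fderiv ℝ η) x v w := by
    have hη : DifferentiableAt ℝ (fderiv ℝ η) x :=
      ((η.smooth 2).fderiv_right (m := 1) (by norm_num)).differentiable (by norm_num) x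
    rw [SchwartzMap.lineDerivOp_apply_eq_fderiv,
      funext (SchwartzMap.lineDerivOp_apply_eq_fderiv w η),
      fderiv_clm_apply hη (differentiableAt_const w)]
    simp
  ext x
  rw [hsecond, hsecond]
  exact ((η.smooth 2).contDiffAt.isSymmSndFDerivAt (by simp)) v w

theorem integral_inner_lineDerivOp_right_eq_neg_left [FiniteDimensional ℝ E] [MeasurableSpace E]
    [BorelSpace E] {μ : Measure E} [μ.IsAddHaarMeasure] [NormedAddCommGroup F]
    [InnerProductSpace ℂ F] (η ζ : 𝓢(E, F)) (v : E) :
    ∫ x, ⟪η x, ∂_{v} ζ x⟫_ℂ ∂μ = -∫ x, ⟪∂_{v} η x, ζ x⟫_ℂ ∂μ :=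
  SchwartzMap.integral_bilinear_lineDerivOp_right_eq_neg_left η ζ
    (isBoundedBilinearMap_inner (𝕜 := ℂ)).toContinuousLinearMap v

end SchwartzDerivatives

variable {M : ℕ}

/-- `ket` as a continuous linear map. -/
noncomputable def ketCLM (M : ℕ) : TestSpace M →L[ℂ] ModeSpace M := SchwartzMap.toLpCLM ℂ ℂ 2 volume

theorem ketCLM_apply (η : TestSpace M) : ketCLM M η = ket η := rfl

theorem denseRange_ket : DenseRange (ket : TestSpace M → ModeSpace M) :=
  SchwartzMap.denseRange_toLpCLM (F := ℂ) (E := Conf M) (p := 2) (μ := volume) (by simp)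

theorem inner_ket (η ζ : TestSpace M) : ⟪ket η, ket ζ⟫_ℂ = ∫ x, ⟪η x, ζ x⟫_ℂ :=
  SchwartzMap.inner_toL2_toL2_eq η ζ

/-- `B` is a formal adjoint of `A` on Schwartz space; `IsHermitianObservable W` unfolds to
`IsFormalAdjoint W W`. -/
def IsFormalAdjoint (A B : Op M) : Prop :=
  ∀ η ζ : TestSpace M, ⟪ket (A η), ket ζ⟫_ℂ = ⟪ket η, ket (B ζ)⟫_ℂ

namespace IsFormalAdjoint

variable {A B A' B' : Op M}

theorem one : IsFormalAdjoint (1 : Op M) 1 := fun _ _ => rfl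

theorem symm (h : IsFormalAdjoint A B) : IsFormalAdjoint B A := fun η ζ => by
  rw [← inner_conj_symm, ← h, inner_conj_symm]

theorem add (h : IsFormalAdjoint A B) (h' : IsFormalAdjoint A' B') :
    IsFormalAdjoint (A + A') (B + B') := fun η ζ => by
  simp only [add_apply, ← ketCLM_apply, map_add, inner_add_left, inner_add_right]
  exact congrArg₂ _ (h η ζ) (h' η ζ)

theorem smul (c : ℂ) (h : IsFormalAdjoint A B) :
    IsFormalAdjoint (c • A) (starRingEnd ℂ c • B) := fun η ζ => by
  simp only [smul_apply, ← ketCLM_apply, map_smul, inner_smul_left, inner_smul_right]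
  exact congrArg _ (h η ζ)

theorem real_smul (r : ℝ) (h : IsFormalAdjoint A B) :
    IsFormalAdjoint ((r : ℂ) • A) ((r : ℂ) • B) := by
  simpa only [Complex.conj_ofReal] using h.smul r

theorem sub (h : IsFormalAdjoint A B) (h' : IsFormalAdjoint A' B') :
    IsFormalAdjoint (A - A') (B - B') := by
  simpa [sub_eq_add_neg] using h.add (h'.smul (-1))

theorem mul (h : IsFormalAdjoint A B) (h' : IsFormalAdjoint A' B') :
    IsFormalAdjoint (A * A') (B' * B) := fun η ζ => (h (A' η) ζ).trans (h' η (B ζ))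

theorem sum {ι : Type*} {t : Finset ι} {A B : ι → Op M} (h : ∀ i, IsFormalAdjoint (A i) (B i)) :
    IsFormalAdjoint (∑ i ∈ t, A i) (∑ i ∈ t, B i) := fun η ζ => by
  simp only [sum_apply, ← ketCLM_apply, map_sum, sum_inner, inner_sum]
  exact Finset.sum_congr rfl fun i _ => h i η ζ

end IsFormalAdjoint

theorem isFormalAdjoint_X (k : Fin M) : IsFormalAdjoint (X k) (X k) := fun η ζ => by
  rw [inner_ket, inner_ket]
  congr with x
  rw [X_apply, X_apply, ← smul_eq_mul, ← smul_eq_mul, inner_smul_left, inner_smul_right,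
    Complex.conj_ofReal]

theorem isFormalAdjoint_P (k : Fin M) : IsFormalAdjoint (P k) (P k) := by
  intro η ζ
  let D := LineDeriv.lineDerivOpCLM ℂ (TestSpace M) (EuclideanSpace.single k (1 : ℝ))
  have hD : ⟪ket η, ket (D ζ)⟫_ℂ = -⟪ket (D η), ket ζ⟫_ℂ := by
    rw [inner_ket, inner_ket]
    exact integral_inner_lineDerivOp_right_eq_neg_left η ζ _
  change ⟪ketCLM M (-Complex.I • D η), ket ζ⟫_ℂ = ⟪ket η, ketCLM M (-Complex.I • D ζ)⟫_ℂ
  rw [map_smul, map_smul, inner_smul_left, inner_smul_right, ketCLM_apply, ketCLM_apply, hD]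
  simp

/-- The coordinate `x ↦ xₖ` as a complex-valued linear map. -/
noncomputable def coordCLM (k : Fin M) : Conf M →L[ℝ] ℂ :=
  Complex.ofRealCLM.comp (EuclideanSpace.proj k : Conf M →L[ℝ] ℝ)

theorem coordCLM_apply (k : Fin M) (x : Conf M) : coordCLM k x = (x k : ℂ) := rfl

section Commutators

attribute [local instance] LieRing.ofAssociativeRing

theorem lie_X_X (k l : Fin M) : ⁅(X k : Op M), X l⁆ = 0 := by
  ext η x
  simp only [Ring.lie_def, sub_apply, mul_apply_eq_comp, X_apply, zero_apply]
  ring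

theorem lie_P_P (k l : Fin M) : ⁅(P k : Op M), P l⁆ = 0 := by
  rw [P, P, smul_lie, lie_smul, ← smul_assoc]
  convert smul_zero _
  ext1 η
  exact sub_eq_zero.2 (lineDerivOp_comm _ _ η)

theorem lie_X_P (k l : Fin M) : ⁅(X k : Op M), P l⁆ = if k = l then Complex.I • 1 else 0 := by
  ext η x
  have hcoord : HasLineDerivAt ℝ (fun x : Conf M => ((x k : ℝ) : ℂ)) (if k = l then 1 else 0) x
      (EuclideanSpace.single l (1 : ℝ)) := by
    have hvalue : coordCLM k (EuclideanSpace.single l 1) = if k = l then 1 else 0 := by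
      simp [coordCLM_apply, PiLp.single_apply, apply_ite]
    rw [← hvalue]
    exact (coordCLM k).hasFDerivAt.hasLineDerivAt _
  have hη := (η.differentiable x).lineDifferentiableAt.hasLineDerivAt
    (v := EuclideanSpace.single l (1 : ℝ))
  have hleibniz : lineDeriv ℝ (X k η) x (EuclideanSpace.single l (1 : ℝ)) =
      (if k = l then 1 else 0) * η x + x k * lineDeriv ℝ η x (EuclideanSpace.single l (1 : ℝ)) := by
    rw [funext (X_apply k η)]
    refine (HasDerivAt.mul hcoord hη).deriv.trans ?_
    simp
  simp only [Ring.lie_def, sub_apply, mul_apply_eq_comp, X_apply, P_apply, hleibniz]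
  split_ifs <;> simp <;> ring

/-- The momentum `p̂ₖ - 3γ x̂ₖ²`, obtained from `p̂ₖ` by conjugation with the cubic phase gate
`exp(iγx̂ₖ³)`. -/
noncomputable def shearedMomentum (γ : ℝ) (k : Fin M) : Op M := P k - ((3 * γ : ℝ) : ℂ) • X k ^ 2

/-- The annihilation operator of mode `k` whose vacuum is the squeezed cubic phase state. -/
noncomputable def lowering (γ s : ℝ) (k : Fin M) : Op M :=
  ((√2 : ℝ) : ℂ)⁻¹ • ((s⁻¹ : ℂ) • X k + (Complex.I * s) • shearedMomentum γ k)

/-- The creation operator of mode `k`, the formal adjoint of `lowering γ s k`. -/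
noncomputable def raising (γ s : ℝ) (k : Fin M) : Op M :=
  ((√2 : ℝ) : ℂ)⁻¹ • ((s⁻¹ : ℂ) • X k - (Complex.I * s) • shearedMomentum γ k)

theorem lie_X_X_sq (k l : Fin M) : ⁅(X k : Op M), X l ^ 2⁆ = 0 :=
  ((commute_iff_lie_eq.2 (lie_X_X k l)).pow_right 2).lie_eq

theorem lie_X_shearedMomentum (γ : ℝ) (k l : Fin M) :
    ⁅(X k : Op M), shearedMomentum γ l⁆ = if k = l then Complex.I • 1 else 0 := by
  rw [shearedMomentum, lie_sub, lie_smul, lie_X_X_sq, lie_X_P, smul_zero, sub_zero]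

theorem lie_shearedMomentum_X (γ : ℝ) (k l : Fin M) :
    ⁅(shearedMomentum γ k : Op M), X l⁆ = -if k = l then Complex.I • 1 else 0 := by
  rw [← lie_skew, lie_X_shearedMomentum]
  simp only [eq_comm]

theorem lie_shearedMomentum_shearedMomentum (γ : ℝ) (k l : Fin M) :
    ⁅(shearedMomentum γ k : Op M), shearedMomentum γ l⁆ = 0 := by
  rcases eq_or_ne k l with rfl | hkl
  · exact lie_self _
  have hX : Commute (X k ^ 2 : Op M) (shearedMomentum γ l) :=
    (commute_iff_lie_eq.2 ((lie_X_shearedMomentum γ k l).trans (if_neg hkl))).pow_left 2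
  have hP : Commute (P k : Op M) (X l ^ 2) :=
    (commute_iff_lie_eq.2 ((lie_X_P l k).trans (if_neg hkl.symm))).symm.pow_right 2
  calc ⁅(shearedMomentum γ k : Op M), shearedMomentum γ l⁆
      = ⁅(P k : Op M), shearedMomentum γ l⁆ := by
        rw [shearedMomentum, sub_lie, smul_lie, hX.lie_eq, smul_zero, sub_zero]
    _ = 0 := by rw [shearedMomentum, lie_sub, lie_smul, hP.lie_eq, lie_P_P, smul_zero, sub_zero]

theorem inv_ofReal_sqrt_two_sq : ((√2 : ℝ) : ℂ)⁻¹ ^ 2 = 1 / 2 := by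
  rw [inv_pow, ← Complex.ofReal_pow, Real.sq_sqrt zero_le_two, Complex.ofReal_ofNat, one_div]

theorem lie_raising_raising (γ s : ℝ) (k l : Fin M) :
    ⁅(raising γ s k : Op M), raising γ s l⁆ = 0 := by
  simp only [raising, smul_lie, lie_smul, sub_lie, lie_sub, lie_X_X, lie_X_shearedMomentum,
    lie_shearedMomentum_X, lie_shearedMomentum_shearedMomentum]
  module

theorem lie_lowering_raising (γ : ℝ) {s : ℝ} (hs : s ≠ 0) (k l : Fin M) :
    ⁅(lowering γ s k : Op M), raising γ s l⁆ = if k = l then 1 else 0 := by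
  have hsinv : (s : ℂ)⁻¹ * s = 1 := inv_mul_cancel₀ (by exact_mod_cast hs)
  simp only [lowering, raising, smul_lie, lie_smul, add_lie, lie_sub, lie_X_X,
    lie_X_shearedMomentum, lie_shearedMomentum_X, lie_shearedMomentum_shearedMomentum]
  split_ifs
  · match_scalars
    linear_combination (-2 * Complex.I ^ 2 * s⁻¹ * s) * inv_ofReal_sqrt_two_sq -
      Complex.I ^ 2 * hsinv - Complex.I_sq
  · simp

theorem add_pow_three_sub_sub_pow_three {A : Type*} [Ring A] {x p : A} (h : ⁅x, ⁅x, p⁆⁆ = 0) :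
    (x + p) ^ 3 - (x - p) ^ 3 = 3 • (x ^ 2 * p + p * x ^ 2) + 2 • p ^ 3 := by
  rw [← sub_eq_zero, ← neg_eq_zero, ← h, Ring.lie_def, Ring.lie_def]
  noncomm_ring

theorem w_eq (γ s : ℝ) (k : Fin M) :
    w γ s k = ((1 / (2 * s ^ 2) : ℝ) : ℂ) • X k ^ 2 +
      ((s ^ 2 / 2 : ℝ) : ℂ) • shearedMomentum γ k ^ 2 := by
  have hcubes := add_pow_three_sub_sub_pow_three (x := (X k : Op M)) (p := P k)
    (by rw [lie_X_P, if_pos rfl, lie_smul, Ring.lie_def, mul_one, one_mul, sub_self, smul_zero])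
  have hsq : (shearedMomentum γ k : Op M) ^ 2 = P k ^ 2 -
      ((3 * γ : ℝ) : ℂ) • (X k ^ 2 * P k + P k * X k ^ 2) + ((9 * γ ^ 2 : ℝ) : ℂ) • X k ^ 4 := by
    simp only [shearedMomentum, pow_succ, pow_zero, one_mul, sub_mul, mul_sub, smul_mul_assoc,
      mul_smul_comm, mul_assoc]
    push_cast
    module
  rw [w, hsq, ← neg_sub, hcubes]
  push_cast
  module

theorem raising_mul_lowering (γ : ℝ) {s : ℝ} (hs : s ≠ 0) (k : Fin M) :
    raising γ s k * lowering γ s k = w γ s k - (1 / 2 : ℂ) • (1 : Op M) := by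
  have hsinv : (s : ℂ)⁻¹ * s = 1 := inv_mul_cancel₀ (by exact_mod_cast hs)
  have hcomm : (X k : Op M) * shearedMomentum γ k = shearedMomentum γ k * X k + Complex.I • 1 :=
    sub_eq_iff_eq_add'.1 ((lie_X_shearedMomentum γ k k).trans (if_pos rfl))
  simp only [raising, lowering, w_eq, sub_mul, mul_add, smul_mul_assoc, mul_smul_comm, hcomm, sq]
  push_cast
  match_scalars
  · linear_combination (s : ℂ)⁻¹ ^ 2 * inv_ofReal_sqrt_two_sq
  · ring
  · linear_combination Complex.I ^ 2 * ((√2 : ℝ) : ℂ)⁻¹ ^ 2 * hsinv +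
      Complex.I ^ 2 * inv_ofReal_sqrt_two_sq + 1 / 2 * Complex.I_sq
  · linear_combination -(Complex.I ^ 2 * s ^ 2) * inv_ofReal_sqrt_two_sq -
      s ^ 2 / 2 * Complex.I_sq

theorem witness_eq (γ : ℝ) {s : ℝ} (hs : s ≠ 0) (M : ℕ) :
    witness γ s M = 1 - ∑ k, raising γ s k * lowering γ s k := by
  simp only [witness, raising_mul_lowering γ hs, Finset.sum_sub_distrib, Finset.sum_const,
    Finset.card_univ, Fintype.card_fin]
  rw [← Nat.cast_smul_eq_nsmul ℂ]
  module

end Commutators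

theorem isFormalAdjoint_lowering (γ s : ℝ) (k : Fin M) :
    IsFormalAdjoint (lowering γ s k) (raising γ s k) := by
  have hY : IsFormalAdjoint (shearedMomentum γ k) (shearedMomentum γ k) := by
    rw [shearedMomentum, sq]
    exact (isFormalAdjoint_P k).sub (((isFormalAdjoint_X k).mul (isFormalAdjoint_X k)).real_smul _)
  have h := (((isFormalAdjoint_X k).smul (s⁻¹ : ℂ)).add (hY.smul (Complex.I * s))).smul
    ((√2 : ℝ) : ℂ)⁻¹
  rw [lowering, raising]
  simpa only [map_inv₀, map_mul, Complex.conj_ofReal, Complex.conj_I, neg_mul, neg_smul,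
    ← sub_eq_add_neg] using h

theorem isHermitianObservable_witness (γ : ℝ) {s : ℝ} (hs : s ≠ 0) (M : ℕ) :
    IsHermitianObservable (witness γ s M) := by
  have h : IsFormalAdjoint (witness γ s M) (witness γ s M) := by
    rw [witness_eq γ hs]
    exact .sub .one <| .sum fun k =>
      (isFormalAdjoint_lowering γ s k).symm.mul (isFormalAdjoint_lowering γ s k)
  exact h

theorem quadrature_zero (k : Fin M) : quadrature k 0 = X k := by simp [quadrature]

theorem quadrature_pi_div_two (k : Fin M) : quadrature k (Real.pi / 2) = P k := by
  simp [quadrature]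

theorem ofReal_sqrt_two_mul_half : ((√2 : ℝ) : ℂ) * ((√2 / 2 : ℝ) : ℂ) = 1 := by
  rw [← Complex.ofReal_mul, ← mul_div_assoc, Real.mul_self_sqrt zero_le_two, div_self two_ne_zero,
    Complex.ofReal_one]

theorem sqrt_two_smul_quadrature_pi_div_four (k : Fin M) :
    ((√2 : ℝ) : ℂ) • quadrature k (Real.pi / 4) = X k + P k := by
  rw [quadrature, Real.cos_pi_div_four, Real.sin_pi_div_four, ← smul_add, smul_smul,
    ofReal_sqrt_two_mul_half, one_smul]

theorem sqrt_two_smul_quadrature_neg_pi_div_four (k : Fin M) :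
    ((√2 : ℝ) : ℂ) • quadrature k (-(Real.pi / 4)) = X k - P k := by
  rw [quadrature, Real.cos_neg, Real.sin_neg, Real.cos_pi_div_four, Real.sin_pi_div_four,
    Complex.ofReal_neg, neg_smul, ← sub_eq_add_neg, ← smul_sub, smul_smul,
    ofReal_sqrt_two_mul_half, one_smul]

theorem homodyneMeasurable_smul_one_add_sum {n d b : ℕ} (c : ℝ) (lam phase : Fin n → ℝ)
    (deg : Fin n → ℕ) (hdeg : ∀ j, deg j ≤ d) (hphase : (Set.range phase).ncard ≤ b) :
    HomodyneMeasurable (n * M) d b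
      ((c : ℂ) • 1 + ∑ k : Fin M, ∑ j, (lam j : ℂ) • quadrature k (phase j) ^ deg j) := by
  let e : Fin (n * M) ≃ Fin n × Fin M := finProdFinEquiv.symm
  refine ⟨n * M, c, fun i => lam (e i).1, fun i => (e i).2, fun i => phase (e i).1,
    fun i => deg (e i).1, le_rfl, fun i => hdeg _, fun k => ?_, ?_⟩
  · refine (Set.ncard_le_ncard ?_ (Set.finite_range phase)).trans hphase
    rintro _ ⟨i, -, rfl⟩
    exact Set.mem_range_self _
  · rw [← Fintype.sum_prod_type_right' fun j k => (lam j : ℂ) • quadrature k (phase j) ^ deg j,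
      ← e.sum_comp]

theorem homodyneMeasurable_witness (γ s : ℝ) (M : ℕ) :
    HomodyneMeasurable (6 * M) 4 4 (witness γ s M) := by
  let phase : Fin 6 → ℝ := ![0, 0, Real.pi / 2, Real.pi / 2, -(Real.pi / 4), Real.pi / 4]
  have hphase : (Set.range phase).ncard ≤ 4 := by
    let values : Finset ℝ := {0, Real.pi / 2, -(Real.pi / 4), Real.pi / 4}
    have hrange : Set.range phase ⊆ values := by
      rw [Set.range_subset_iff]
      simp [Fin.forall_fin_succ, phase, values]
    refine (Set.ncard_le_ncard hrange values.finite_toSet).trans ?_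
    rw [Set.ncard_coe_finset]
    exact Finset.card_le_four
  convert homodyneMeasurable_smul_one_add_sum (M := M) (d := 4) (1 + M / 2)
    ![-(1 / (2 * s ^ 2)), -(s ^ 2 / 2 * (9 * γ ^ 2)), -(s ^ 2 / 2), -(s ^ 2 / 2 * (2 * γ)),
      -(s ^ 2 / 2 * γ * √2 ^ 3), s ^ 2 / 2 * γ * √2 ^ 3]
    phase ![2, 4, 2, 3, 3, 3] (by decide) hphase using 1
  rw [witness, sub_eq_add_neg, ← Finset.sum_neg_distrib]
  congr 1
  · push_cast; rfl
  · refine Finset.sum_congr rfl fun k _ => ?_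
    rw [w, ← sqrt_two_smul_quadrature_pi_div_four, ← sqrt_two_smul_quadrature_neg_pi_div_four]
    simp only [phase, Fin.sum_univ_six, Matrix.cons_val, quadrature_zero, quadrature_pi_div_two,
      smul_pow]
    push_cast
    module

section Decay

variable {E : Type*} [NormedAddCommGroup E]

theorem exists_pow_norm_mul_mul_le {a b : E → ℝ} {m : ℕ} {C : ℝ} (ha : ∀ x, 0 ≤ a x) (hC : 0 ≤ C)
    (hdecay : ∀ k : ℕ, ∃ D, ∀ x, ‖x‖ ^ k * a x ≤ D) (hgrowth : ∀ x, b x ≤ C * (1 + ‖x‖) ^ m)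
    (k : ℕ) : ∃ D, ∀ x, ‖x‖ ^ k * (a x * b x) ≤ D := by
  obtain ⟨D₁, hD₁⟩ := hdecay k
  obtain ⟨D₂, hD₂⟩ := hdecay (k + m)
  refine ⟨C * 2 ^ (m - 1) * (D₁ + D₂), fun x => ?_⟩
  have hpow : (1 + ‖x‖) ^ m ≤ 2 ^ (m - 1) * (1 + ‖x‖ ^ m) := by
    simpa only [one_pow] using add_pow_le zero_le_one (norm_nonneg x) m
  have hax := ha x
  calc ‖x‖ ^ k * (a x * b x)
      ≤ ‖x‖ ^ k * (a x * (C * (2 ^ (m - 1) * (1 + ‖x‖ ^ m)))) := by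
        gcongr
        exact (hgrowth x).trans (by gcongr)
    _ = C * 2 ^ (m - 1) * (‖x‖ ^ k * a x + ‖x‖ ^ (k + m) * a x) := by ring
    _ ≤ C * 2 ^ (m - 1) * (D₁ + D₂) := by
        gcongr
        · exact hD₁ x
        · exact hD₂ x

theorem exists_pow_norm_mul_iteratedFDeriv_le_of_fderiv_eq_smul {𝕜 : Type*} [RCLike 𝕜]
    [NormedSpace ℝ E] {f : E → 𝕜} {g : E → E →L[ℝ] 𝕜} (hf : ContDiff ℝ ∞ f)
    (hg : g.HasTemperateGrowth) (hfg : ∀ x, fderiv ℝ f x = f x • g x)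
    (hdecay : ∀ k : ℕ, ∃ C, ∀ x, ‖x‖ ^ k * ‖f x‖ ≤ C) (k n : ℕ) :
    ∃ C, ∀ x, ‖x‖ ^ k * ‖iteratedFDeriv ℝ n f x‖ ≤ C := by
  induction n using Nat.strong_induction_on generalizing k with
  | _ n ih =>
    rcases n with _ | n
    · simpa using hdecay k
    obtain ⟨m, C, hC, hgrowth⟩ := hg.norm_iteratedFDeriv_le_uniform n
    have hterm (i) (hi : i ∈ Finset.range (n + 1)) : ∃ D, ∀ x, ‖x‖ ^ k *
        (‖iteratedFDeriv ℝ i f x‖ * ‖iteratedFDeriv ℝ (n - i) g x‖) ≤ D :=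
      exists_pow_norm_mul_mul_le (fun _ => norm_nonneg _) hC
        (fun k => ih i (Finset.mem_range.1 hi) k) (hgrowth (n - i) (Nat.sub_le _ _)) k
    choose! D hD using hterm
    refine ⟨∑ i ∈ Finset.range (n + 1), n.choose i * D i, fun x => ?_⟩
    calc ‖x‖ ^ k * ‖iteratedFDeriv ℝ (n + 1) f x‖
        = ‖x‖ ^ k * ‖iteratedFDeriv ℝ n (fun x => f x • g x) x‖ := by
          rw [← norm_iteratedFDeriv_fderiv, funext hfg]
      _ ≤ ‖x‖ ^ k * ∑ i ∈ Finset.range (n + 1), n.choose i * ‖iteratedFDeriv ℝ i f x‖ *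
            ‖iteratedFDeriv ℝ (n - i) g x‖ := by
          gcongr
          exact norm_iteratedFDeriv_smul_le hf hg.1 x (by exact_mod_cast le_top)
      _ ≤ ∑ i ∈ Finset.range (n + 1), n.choose i * D i := by
          rw [Finset.mul_sum]
          refine Finset.sum_le_sum fun i hi => ?_
          rw [mul_assoc, mul_left_comm]
          gcongr
          exact hD i hi x

theorem pow_mul_exp_neg_mul_sq_le {a : ℝ} (ha : 0 < a) (k : ℕ) {t : ℝ} (ht : 0 ≤ t) :
    t ^ k * Real.exp (-a * t ^ 2) ≤ k.factorial * Real.exp (1 / (4 * a)) := by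
  have hsq : t + -a * t ^ 2 ≤ 1 / (4 * a) := by
    have h : 1 / (4 * a) - (t + -a * t ^ 2) = (2 * a * t - 1) ^ 2 / (4 * a) := by
      field_simp
      ring
    exact sub_nonneg.1 (h ▸ by positivity)
  calc t ^ k * Real.exp (-a * t ^ 2)
      ≤ (k.factorial * Real.exp t) * Real.exp (-a * t ^ 2) := by
        gcongr
        exact (div_le_iff₀' (by positivity)).1 (Real.pow_div_factorial_le_exp t ht k)
    _ = k.factorial * Real.exp (t + -a * t ^ 2) := by rw [mul_assoc, ← Real.exp_add]
    _ ≤ k.factorial * Real.exp (1 / (4 * a)) := by gcongr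

end Decay

/-- The logarithmic derivative of `cubicPhaseWave γ s`, as a polynomial in a complex variable. -/
noncomputable def cubicPhaseLogDeriv (γ s : ℝ) (z : ℂ) : ℂ :=
  3 * Complex.I * γ * z ^ 2 - z / s ^ 2

/-- The logarithmic derivative of `targetWave γ s M`. -/
noncomputable def targetLogDeriv (γ s : ℝ) (M : ℕ) (x : Conf M) : Conf M →L[ℝ] ℂ :=
  ∑ k, cubicPhaseLogDeriv γ s (x k) • coordCLM k

theorem targetLogDeriv_single (γ s : ℝ) (x : Conf M) (k : Fin M) :
    targetLogDeriv γ s M x (EuclideanSpace.single k 1) = cubicPhaseLogDeriv γ s (x k) := by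
  simp [targetLogDeriv, coordCLM_apply, sum_apply, PiLp.single_apply, apply_ite]

theorem hasFDerivAt_targetWave (γ s : ℝ) (M : ℕ) (x : Conf M) :
    HasFDerivAt (targetWave γ s M) (targetWave γ s M x • targetLogDeriv γ s M x) x := by
  have hfactor (k : Fin M) : HasFDerivAt (fun x : Conf M => cubicPhaseWave γ s (x k))
      ((cubicPhaseWave γ s (x k) * cubicPhaseLogDeriv γ s (x k)) • coordCLM k) x := by
    have hcubic := ((hasDerivAt_pow 3 (x k : ℂ)).const_mul (Complex.I * γ)).cexp
    have hgauss := ((hasDerivAt_pow 2 (x k : ℂ)).fun_neg.div_const (2 * (s : ℂ) ^ 2)).cexp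
    refine HasDerivAt.comp_hasFDerivAt x (((hcubic.mul hgauss).div_const _).congr_deriv ?_)
      (coordCLM k).hasFDerivAt
    simp only [cubicPhaseWave, cubicPhaseLogDeriv]
    push_cast
    ring
  refine (HasFDerivAt.finsetProd fun k _ => hfactor k).congr_fderiv ?_
  simp only [targetLogDeriv, targetWave, Finset.smul_sum, smul_smul, ← mul_assoc]
  exact Finset.sum_congr rfl fun k hk => by rw [Finset.prod_erase_mul _ _ hk]

theorem hasTemperateGrowth_targetLogDeriv (γ s : ℝ) (M : ℕ) :
    (targetLogDeriv γ s M).HasTemperateGrowth := by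
  refine .sum fun k _ => Function.HasTemperateGrowth.smul (𝕜 := ℂ) ?_ (.const (coordCLM k))
  have hcoord : (fun x : Conf M => (x k : ℂ)).HasTemperateGrowth := (coordCLM k).hasTemperateGrowth
  simp only [cubicPhaseLogDeriv, div_eq_mul_inv]
  exact ((Function.HasTemperateGrowth.const _).mul (hcoord.pow 2)).sub (hcoord.mul (.const _))

theorem contDiff_targetWave (γ s : ℝ) (M : ℕ) : ContDiff ℝ ∞ (targetWave γ s M) := by
  have hcoord (k : Fin M) : ContDiff ℝ ∞ fun x : Conf M => (x k : ℂ) := (coordCLM k).contDiff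
  unfold targetWave cubicPhaseWave
  fun_prop

theorem norm_cubicPhaseWave (γ s t : ℝ) : ‖cubicPhaseWave γ s t‖ =
    (√s * Real.pi ^ (1 / 4 : ℝ))⁻¹ * Real.exp (-(2 * s ^ 2)⁻¹ * t ^ 2) := by
  have hnorm : 0 ≤ √s * Real.pi ^ (1 / 4 : ℝ) := by positivity
  have hcubic : Complex.I * γ * t ^ 3 = ((γ * t ^ 3 : ℝ) : ℂ) * Complex.I := by push_cast; ring
  have hgauss : -(t : ℂ) ^ 2 / (2 * s ^ 2) = ((-(2 * s ^ 2)⁻¹ * t ^ 2 : ℝ) : ℂ) := by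
    push_cast; ring
  rw [cubicPhaseWave, hcubic, hgauss, norm_div, norm_mul, Complex.norm_exp_ofReal_mul_I,
    Complex.norm_exp_ofReal, Complex.norm_real, Real.norm_of_nonneg hnorm, one_mul, div_eq_inv_mul]

theorem norm_targetWave (γ s : ℝ) (M : ℕ) (x : Conf M) : ‖targetWave γ s M x‖ =
    (√s * Real.pi ^ (1 / 4 : ℝ))⁻¹ ^ M * Real.exp (-(2 * s ^ 2)⁻¹ * ‖x‖ ^ 2) := by
  rw [targetWave, norm_prod]
  simp only [norm_cubicPhaseWave]
  rw [Finset.prod_mul_distrib, Finset.prod_const, Finset.card_univ, Fintype.card_fin,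
    ← Real.exp_sum, ← Finset.mul_sum, EuclideanSpace.real_norm_sq_eq]

/-- The target wave function as a Schwartz function. -/
noncomputable def targetSchwartz (γ : ℝ) {s : ℝ} (hs : 0 < s) (M : ℕ) : TestSpace M where
  toFun := targetWave γ s M
  smooth' := contDiff_targetWave γ s M
  decay' := by
    refine exists_pow_norm_mul_iteratedFDeriv_le_of_fderiv_eq_smul (contDiff_targetWave γ s M)
      (hasTemperateGrowth_targetLogDeriv γ s M) (fun x => (hasFDerivAt_targetWave γ s M x).fderiv)
      fun k => ⟨(√s * Real.pi ^ (1 / 4 : ℝ))⁻¹ ^ M *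
        (k.factorial * Real.exp (1 / (4 * (2 * s ^ 2)⁻¹))), fun x => ?_⟩
    rw [norm_targetWave, mul_left_comm]
    exact mul_le_mul_of_nonneg_left
      (pow_mul_exp_neg_mul_sq_le (by positivity) k (norm_nonneg x)) (by positivity)

theorem targetSchwartz_apply (γ : ℝ) {s : ℝ} (hs : 0 < s) (x : Conf M) :
    targetSchwartz γ hs M x = targetWave γ s M x := rfl

theorem ket_targetSchwartz (γ : ℝ) {s : ℝ} (hs : 0 < s) (M : ℕ) :
    ket (targetSchwartz γ hs M) = targetVec γ hs M := rfl

theorem integral_norm_cubicPhaseWave_sq (γ : ℝ) {s : ℝ} (hs : 0 < s) :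
    ∫ t : ℝ, ‖cubicPhaseWave γ s t‖ ^ 2 = 1 := by
  have hpi : (Real.pi ^ (1 / 4 : ℝ)) ^ 2 = √Real.pi := by
    rw [Real.sqrt_eq_rpow, ← Real.rpow_mul_natCast Real.pi_pos.le]
    norm_num
  have hsq (t : ℝ) : ‖cubicPhaseWave γ s t‖ ^ 2 =
      (s * √Real.pi)⁻¹ * Real.exp (-(s ^ 2)⁻¹ * t ^ 2) := by
    rw [norm_cubicPhaseWave, mul_pow, inv_pow, mul_pow, Real.sq_sqrt hs.le, hpi, ← Real.exp_nat_mul]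
    congr 2
    push_cast
    ring
  simp_rw [hsq]
  rw [integral_const_mul, integral_gaussian, div_inv_eq_mul, Real.sqrt_mul Real.pi_pos.le,
    Real.sqrt_sq hs.le, mul_comm √Real.pi]
  exact inv_mul_cancel₀ (by positivity)

theorem integral_norm_targetWave_sq (γ : ℝ) {s : ℝ} (hs : 0 < s) (M : ℕ) :
    ∫ x : Conf M, ‖targetWave γ s M x‖ ^ 2 = 1 := by
  simp_rw [targetWave, norm_prod, ← Finset.prod_pow]
  refine ((EuclideanSpace.volume_preserving_symm_measurableEquiv_toLp (Fin M)).integral_comp'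
    fun y : Fin M → ℝ => ∏ k, ‖cubicPhaseWave γ s (y k)‖ ^ 2).trans ?_
  rw [volume_pi, integral_fintype_prod_eq_prod fun (_ : Fin M) (t : ℝ) =>
    ‖cubicPhaseWave γ s t‖ ^ 2]
  simp [integral_norm_cubicPhaseWave_sq γ hs]

theorem norm_targetVec (γ : ℝ) {s : ℝ} (hs : 0 < s) (M : ℕ) : ‖targetVec γ hs M‖ = 1 := by
  have hsq : ‖targetVec γ hs M‖ ^ 2 = 1 := by
    apply Complex.ofReal_injective
    push_cast
    rw [← ket_targetSchwartz, ← Complex.coe_algebraMap, ← inner_self_eq_norm_sq_to_K, inner_ket]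
    simp only [inner_self_eq_norm_sq_to_K, targetSchwartz_apply]
    exact_mod_cast congrArg _ (integral_norm_targetWave_sq γ hs M)
  exact (pow_eq_one_iff_of_nonneg (norm_nonneg _) two_ne_zero).1 hsq

theorem lowering_targetSchwartz (γ : ℝ) {s : ℝ} (hs : 0 < s) (k : Fin M) :
    lowering γ s k (targetSchwartz γ hs M) = 0 := by
  have hs' : (s : ℂ) ≠ 0 := by exact_mod_cast hs.ne'
  ext x
  have hP : P k (targetSchwartz γ hs M) x =
      -Complex.I * (targetWave γ s M x * cubicPhaseLogDeriv γ s (x k)) := by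
    have hderiv : HasFDerivAt (targetSchwartz γ hs M) _ x := hasFDerivAt_targetWave γ s M x
    rw [P_apply, (hderiv.hasLineDerivAt _).lineDeriv, smul_apply, targetLogDeriv_single,
      smul_eq_mul]
  simp only [lowering, shearedMomentum, smul_apply, add_apply, sub_apply, pow_two,
    mul_apply_eq_comp, X_apply, hP, targetSchwartz_apply, smul_eq_mul, zero_apply,
    cubicPhaseLogDeriv]
  push_cast
  field_simp
  linear_combination (x k * targetWave γ s M x -
    3 * Complex.I * γ * x k ^ 2 * s ^ 2 * targetWave γ s M x) * Complex.I_sq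

section Moments

variable {V F : Type*} [NormedAddCommGroup V] [InnerProductSpace ℝ V] [FiniteDimensional ℝ V]
  [MeasurableSpace V] [BorelSpace V] [NormedAddCommGroup F] [NormedSpace ℂ F]
  {h : V → F}

theorem integral_cexp_inner_smul_eq_zero {t : V} (hm : AEStronglyMeasurable h)
    (hexp : Integrable fun x => Real.exp (‖t‖ * ‖x‖) * ‖h x‖)
    (hmoment : ∀ n : ℕ, ∫ x, (inner ℝ t x) ^ n • h x = 0) :
    ∫ x, Complex.exp ((inner ℝ t x : ℝ) * Complex.I) • h x = 0 := by
  let term (n : ℕ) (x : V) : F := (((inner ℝ t x : ℝ) * Complex.I) ^ n / n.factorial) • h x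
  have hsum : HasSum (fun n => ∫ x, term n x)
      (∫ x, Complex.exp ((inner ℝ t x : ℝ) * Complex.I) • h x) := by
    refine hasSum_integral_of_dominated_convergence
      (fun n x => (‖t‖ * ‖x‖) ^ n / n.factorial * ‖h x‖)
      (fun n => (Continuous.aestronglyMeasurable (by fun_prop)).smul hm)
      (fun n => .of_forall fun x => ?_)
      (.of_forall fun x => (Real.summable_pow_div_factorial _).mul_right _)
      (hexp.congr (.of_forall fun x => ?_))
      (.of_forall fun x => ?_)
    · rw [norm_smul, norm_div, norm_pow, norm_mul, Complex.norm_I, mul_one, Complex.norm_real,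
        Complex.norm_natCast]
      gcongr
      exact norm_inner_le_norm t x
    · simp only [tsum_mul_right, Real.exp_eq_exp_ℝ, NormedSpace.exp_eq_tsum_div]
    · rw [Complex.exp_eq_exp_ℂ]
      exact (NormedSpace.expSeries_div_hasSum_exp _).smul_const _
  have hterm (n : ℕ) : ∫ x, term n x = 0 := by
    have hfactor (x : V) :
        term n x = (Complex.I ^ n / n.factorial) • ((inner ℝ t x) ^ n • h x) := by
      simp only [term]
      rw [← Complex.coe_smul, smul_smul, mul_pow]
      congr 1
      push_cast
      ring
    simp_rw [hfactor]
    rw [integral_smul, hmoment, smul_zero]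
  simp only [hterm] at hsum
  exact hsum.unique hasSum_zero

variable [CompleteSpace F]

theorem ae_eq_zero_of_fourier_eq_zero (hh : Integrable h) (hF : 𝓕 h = 0) : ∀ᵐ x, h x = 0 := by
  refine ae_eq_zero_of_integral_contDiff_smul_eq_zero hh.locallyIntegrable fun g hg hgc => ?_
  have hsupp : HasCompactSupport (Complex.ofRealCLM ∘ g) := hgc.comp_left rfl
  let G : 𝓢(V, ℂ) := hsupp.toSchwartzMap (by fun_prop)
  let Φ : 𝓢(V, ℂ) := 𝓕⁻ G
  have hΦ : 𝓕 (⇑Φ) = ⇑G := by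
    rw [← SchwartzMap.fourier_coe, FourierTransform.fourier_fourierInv_eq]
  have hflip : ∫ ξ, 𝓕 (⇑Φ) ξ • h ξ = ∫ x, Φ x • 𝓕 h x := by
    simpa using! VectorFourier.integral_fourierIntegral_smul_eq_flip (L := innerₗ V)
      Real.continuous_fourierChar continuous_inner Φ.integrable hh
  rw [hΦ, hF] at hflip
  simpa [G] using hflip

theorem ae_eq_zero_of_integral_inner_pow_smul_eq_zero (hm : AEStronglyMeasurable h)
    (hexp : ∀ c : ℝ, Integrable fun x => Real.exp (c * ‖x‖) * ‖h x‖)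
    (hmoment : ∀ (t : V) (n : ℕ), ∫ x, (inner ℝ t x) ^ n • h x = 0) : ∀ᵐ x, h x = 0 := by
  have hh : Integrable h := (integrable_norm_iff hm).1 (by simpa using hexp 0)
  refine ae_eq_zero_of_fourier_eq_zero hh ?_
  ext ξ
  rw [Real.fourier_eq', Pi.zero_apply,
    ← integral_cexp_inner_smul_eq_zero hm (hexp _) (hmoment ((-2 * Real.pi) • ξ))]
  simp only [real_inner_smul_left, real_inner_comm ξ]

end Moments

theorem exists_mem_apply_eq_inner_pow_smul {V : Submodule ℂ (TestSpace M)} {ψ : TestSpace M}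
    (hψ : ψ ∈ V) (hX : ∀ k, ∀ v ∈ V, X k v ∈ V) (t : Conf M) (n : ℕ) :
    ∃ v ∈ V, ∀ x, v x = (inner ℝ t x) ^ n • ψ x := by
  induction n with
  | zero => exact ⟨ψ, hψ, fun x => by simp⟩
  | succ n ih =>
    obtain ⟨v, hv, hvx⟩ := ih
    refine ⟨∑ k, (t k : ℂ) • X k v,
      V.sum_mem fun k _ => V.smul_mem _ (hX k v hv), fun x => ?_⟩
    have hinner : (inner ℝ t x : ℝ) = ∑ k, t k * x k := by
      simp [PiLp.inner_apply, mul_comm]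
    simp only [sum_apply, smul_apply, X_apply, hvx, pow_succ, hinner, Complex.real_smul,
      Complex.ofReal_mul, Complex.ofReal_sum, smul_eq_mul, Finset.mul_sum, Finset.sum_mul]
    exact Finset.sum_congr rfl fun k _ => by ring

theorem topologicalClosure_map_ketCLM_eq_top {V : Submodule ℂ (TestSpace M)} {ψ : TestSpace M}
    (hψ : ψ ∈ V) (hX : ∀ k, ∀ v ∈ V, X k v ∈ V) (hne : ∀ x, ψ x ≠ 0)
    (hdecay : ∀ c : ℝ, MemLp (fun x => Real.exp (c * ‖x‖) * ‖ψ x‖) 2) :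
    (V.map (ketCLM M : TestSpace M →ₗ[ℂ] ModeSpace M)).topologicalClosure = ⊤ := by
  rw [Submodule.topologicalClosure_eq_top_iff, eq_bot_iff]
  intro f hf
  let h (x : Conf M) : ℂ := ⟪f x, ψ x⟫_ℂ
  have hm : AEStronglyMeasurable h :=
    (Lp.memLp f).1.inner ψ.continuous.aestronglyMeasurable
  have hexp (c : ℝ) : Integrable fun x => Real.exp (c * ‖x‖) * ‖h x‖ := by
    refine ((hdecay c).integrable_mul (Lp.memLp f).norm).congr (.of_forall fun x => ?_)
    simp only [h, Pi.mul_apply, RCLike.inner_apply, norm_mul, RCLike.norm_conj]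
    ring
  have hmoment (t : Conf M) (n : ℕ) : ∫ x, (inner ℝ t x) ^ n • h x = 0 := by
    obtain ⟨v, hv, hvx⟩ := exists_mem_apply_eq_inner_pow_smul hψ hX t n
    have horth : ⟪f, ket v⟫_ℂ = 0 :=
      (Submodule.mem_orthogonal' _ _).1 hf _ (Submodule.mem_map_of_mem hv)
    rw [← horth, L2.inner_def]
    refine integral_congr_ae ?_
    filter_upwards [v.coeFn_toLp 2 volume] with x hx
    simp only [h, ket]
    rw [hx, hvx, inner_smul_right_eq_smul]
  refine (Submodule.mem_bot ℂ).2 ((Lp.eq_zero_iff_ae_eq_zero).2 ?_)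
  filter_upwards [ae_eq_zero_of_integral_inner_pow_smul_eq_zero hm hexp hmoment] with x hx
  simpa [h, hne] using hx

theorem memLp_exp_norm_mul_targetWave (γ : ℝ) {s : ℝ} (hs : 0 < s) (M : ℕ) (c : ℝ) :
    MemLp (fun x : Conf M => Real.exp (c * ‖x‖) * ‖targetWave γ s M x‖) 2 := by
  have hcont : Continuous (targetWave γ s M) := (contDiff_targetWave γ s M).continuous
  refine (memLp_targetWave γ (s := √2 * s) (by positivity) M).of_le_mul
    (c := √√2 ^ M * Real.exp (c ^ 2 * s ^ 2)) (by fun_prop) (.of_forall fun x => ?_)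
  have hsq : c * ‖x‖ + -(2 * s ^ 2)⁻¹ * ‖x‖ ^ 2 ≤
      c ^ 2 * s ^ 2 + -(2 * (√2 * s) ^ 2)⁻¹ * ‖x‖ ^ 2 := by
    have h : c ^ 2 * s ^ 2 + -(2 * (√2 * s) ^ 2)⁻¹ * ‖x‖ ^ 2 -
        (c * ‖x‖ + -(2 * s ^ 2)⁻¹ * ‖x‖ ^ 2) = (c * s - ‖x‖ / (2 * s)) ^ 2 := by
      rw [mul_pow, Real.sq_sqrt zero_le_two]
      field_simp
      ring
    exact sub_nonneg.1 (h ▸ sq_nonneg _)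
  have hconst : √√2 ^ M * (√(√2 * s) * Real.pi ^ (1 / 4 : ℝ))⁻¹ ^ M =
      (√s * Real.pi ^ (1 / 4 : ℝ))⁻¹ ^ M := by
    rw [← mul_pow, Real.sqrt_mul (Real.sqrt_nonneg 2)]
    congr 1
    field_simp
  calc ‖Real.exp (c * ‖x‖) * ‖targetWave γ s M x‖‖
      = (√s * Real.pi ^ (1 / 4 : ℝ))⁻¹ ^ M *
          Real.exp (c * ‖x‖ + -(2 * s ^ 2)⁻¹ * ‖x‖ ^ 2) := by
        rw [Real.norm_of_nonneg (by positivity), norm_targetWave, Real.exp_add]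
        ring
    _ ≤ (√s * Real.pi ^ (1 / 4 : ℝ))⁻¹ ^ M *
          Real.exp (c ^ 2 * s ^ 2 + -(2 * (√2 * s) ^ 2)⁻¹ * ‖x‖ ^ 2) := by gcongr
    _ = √√2 ^ M * Real.exp (c ^ 2 * s ^ 2) * ‖targetWave γ (√2 * s) M x‖ := by
        rw [norm_targetWave, ← hconst, Real.exp_add]
        ring

theorem X_eq_smul_lowering_add_raising (γ : ℝ) {s : ℝ} (hs : s ≠ 0) (k : Fin M) :
    (X k : Op M) = ((s / √2 : ℝ) : ℂ) • (lowering γ s k + raising γ s k) := by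
  have hs' : (s : ℂ) ≠ 0 := by exact_mod_cast hs
  have hcoeff : (s / (√2 : ℝ) : ℂ) * (((√2 : ℝ) : ℂ)⁻¹ * (s : ℂ)⁻¹) = 1 / 2 := by
    rw [← inv_ofReal_sqrt_two_sq]
    field_simp
  unfold lowering raising
  match_scalars
  · linear_combination -2 * hcoeff
  · ring

/-- The span of the target wave function and all its excitations by the creation operators. -/
noncomputable def excitationSpace (γ : ℝ) {s : ℝ} (hs : 0 < s) (M : ℕ) :
    Submodule ℂ (TestSpace M) :=
  ⨆ n, excitationLayer (fun k => (raising γ s k : Op M).toLinearMap) (targetSchwartz γ hs M) n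

section Endomorphisms

attribute [local instance] LieRing.ofAssociativeRing

theorem lie_toLinearMap (S T : Op M) :
    ⁅(S.toLinearMap : Module.End ℂ (TestSpace M)), T.toLinearMap⁆ = (⁅S, T⁆ : Op M).toLinearMap :=
  rfl

theorem lie_lowering_raising_toLinearMap (γ : ℝ) {s : ℝ} (hs : s ≠ 0) (k l : Fin M) :
    ⁅((lowering γ s k : Op M).toLinearMap : Module.End ℂ (TestSpace M)),
      (raising γ s l : Op M).toLinearMap⁆ = if k = l then 1 else 0 := by
  rw [lie_toLinearMap, lie_lowering_raising γ hs]
  split_ifs <;> rfl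

theorem commute_raising_toLinearMap (γ s : ℝ) (k l : Fin M) :
    Commute ((raising γ s k : Op M).toLinearMap : Module.End ℂ (TestSpace M))
      (raising γ s l : Op M).toLinearMap := by
  rw [commute_iff_lie_eq, lie_toLinearMap, lie_raising_raising]
  rfl

end Endomorphisms

theorem X_mem_excitationSpace (γ : ℝ) {s : ℝ} (hs : 0 < s) (k : Fin M) {v : TestSpace M}
    (hv : v ∈ excitationSpace γ hs M) : X k v ∈ excitationSpace γ hs M := by
  rw [X_eq_smul_lowering_add_raising γ hs.ne']
  exact Submodule.smul_mem _ _ <| add_mem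
    (lowering_mem_iSup_excitationLayer (a := fun k => (lowering γ s k : Op M).toLinearMap)
      (lie_lowering_raising_toLinearMap γ hs.ne') (lowering_targetSchwartz γ hs) k hv)
    (raising_mem_iSup_excitationLayer k hv)

theorem topologicalClosure_excitationSpace (γ : ℝ) {s : ℝ} (hs : 0 < s) (M : ℕ) :
    ((excitationSpace γ hs M).map
      (ketCLM M : TestSpace M →ₗ[ℂ] ModeSpace M)).topologicalClosure = ⊤ := by
  refine topologicalClosure_map_ketCLM_eq_top mem_iSup_excitationLayer_self
    (fun k v => X_mem_excitationSpace γ hs k) (fun x => ?_) (memLp_exp_norm_mul_targetWave γ hs M)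
  rw [targetSchwartz_apply, ← norm_pos_iff, norm_targetWave]
  positivity

theorem re_inner_witness_le (γ : ℝ) {s : ℝ} (hs : 0 < s) (η : TestSpace M) :
    RCLike.re ⟪ket η, ket (witness γ s M η)⟫_ℂ ≤ ‖⟪targetVec γ hs M, ket η⟫_ℂ‖ ^ 2 := by
  have hbound := norm_sq_le_norm_inner_vacuum_sq_add_inner_numberOp
    (a := fun k => (lowering γ s k : Op M).toLinearMap)
    (b := fun k => (raising γ s k : Op M).toLinearMap)
    (ket := (ketCLM M : TestSpace M →ₗ[ℂ] ModeSpace M)) (ψ := targetSchwartz γ hs M)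
    (isFormalAdjoint_lowering γ s) (lie_lowering_raising_toLinearMap γ hs.ne')
    (commute_raising_toLinearMap γ s) (lowering_targetSchwartz γ hs) (norm_targetVec γ hs M)
    (topologicalClosure_excitationSpace γ hs M).ge η
  have hwitness : witness γ s M η = η - numberOp
      (fun k => (lowering γ s k : Op M).toLinearMap)
      (fun k => (raising γ s k : Op M).toLinearMap) η := by
    rw [witness_eq γ hs.ne']
    simp [numberOp, sum_apply]
  rw [hwitness, ← ketCLM_apply, ← ketCLM_apply, map_sub, inner_sub_right, map_sub,
    inner_self_eq_norm_sq]
  exact sub_le_iff_le_add.2 hbound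

section SquareRoot

variable {H : Type*} [NormedAddCommGroup H] [InnerProductSpace ℂ H]

theorem tsum_ofReal_norm_inner_sq {ι : Type*} (e : HilbertBasis ι ℂ H) (v : H) :
    ∑' i, ENNReal.ofReal (‖⟪v, e i⟫_ℂ‖ ^ 2) = ENNReal.ofReal (‖v‖ ^ 2) := by
  have hparseval : HasSum (fun i => ‖⟪v, e i⟫_ℂ‖ ^ 2) (‖v‖ ^ 2) := by
    have h := RCLike.hasSum_re ℂ (e.hasSum_inner_mul_inner v v)
    simpa only [inner_mul_symm_re_eq_norm, norm_mul, norm_inner_symm (e _) v, ← pow_two,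
      inner_self_eq_norm_sq] using h
  rw [← hparseval.tsum_eq,
    ENNReal.ofReal_tsum_of_nonneg (fun _ => sq_nonneg _) hparseval.summable]

variable [CompleteSpace H]

theorem inner_opSqrt_left (ρ : H →L[ℂ] H) (v w : H) :
    ⟪opSqrt ρ v, w⟫_ℂ = ⟪v, opSqrt ρ w⟫_ℂ :=
  (CFC.sqrt_nonneg ρ).isSelfAdjoint.isSymmetric v w

theorem norm_opSqrt_apply_sq {ρ : H →L[ℂ] H} (hρ : ρ.IsPositive) (v : H) :
    ‖opSqrt ρ v‖ ^ 2 = RCLike.re ⟪v, ρ v⟫_ℂ := by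
  have hsq : opSqrt ρ * opSqrt ρ = ρ :=
    CFC.sqrt_mul_sqrt_self ρ ((ContinuousLinearMap.nonneg_iff_isPositive ρ).2 hρ)
  rw [← inner_self_eq_norm_sq (𝕜 := ℂ), inner_opSqrt_left, ← mul_apply_eq_comp, hsq]

theorem opSqrt_rankOne_self {v : H} (hv : ‖v‖ = 1) :
    opSqrt (InnerProductSpace.rankOne ℂ v v) = InnerProductSpace.rankOne ℂ v v :=
  CFC.sqrt_unique (InnerProductSpace.isIdempotentElem_rankOne_self hv)
    ((ContinuousLinearMap.nonneg_iff_isPositive _).2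
      (InnerProductSpace.isPositive_rankOne_self v))

end SquareRoot

section PureState

variable {ι : Type*} (e : HilbertBasis ι ℂ (ModeSpace M)) {v : ModeSpace M}

theorem isDensityOperator_rankOne_self (hv : ‖v‖ = 1) :
    IsDensityOperator e (InnerProductSpace.rankOne ℂ v v) := by
  refine ⟨InnerProductSpace.isPositive_rankOne_self v, ?_⟩
  have hparseval := e.hasSum_inner_mul_inner v v
  rw [inner_self_eq_norm_sq_to_K, hv] at hparseval
  simpa [inner_smul_right] using hparseval

theorem fidelity_rankOne_self (v : ModeSpace M) (ρ : ModeSpace M →L[ℂ] ModeSpace M) :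
    fidelity e (InnerProductSpace.rankOne ℂ v v) ρ = RCLike.re ⟪v, ρ v⟫_ℂ := by
  simp only [fidelity, InnerProductSpace.rankOne_apply, inner_smul_right,
    ← ContinuousLinearMap.adjoint_inner_left ρ, e.tsum_inner_mul_inner]
  rfl

theorem fidelity_rankOne_self_rankOne_self (hv : ‖v‖ = 1) :
    fidelity e (InnerProductSpace.rankOne ℂ v v) (InnerProductSpace.rankOne ℂ v v) = 1 := by
  simp [fidelity_rankOne_self, inner_self_eq_norm_sq_to_K, hv]

end PureState

section Witness

variable {W : Op M}

theorem formValue_le_of_continuous {g : ModeSpace M → ℝ} (hg : Continuous g)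
    (hW : ∀ η, RCLike.re ⟪ket η, ket (W η)⟫_ℂ ≤ g (ket η)) (φ : ModeSpace M) :
    formValue W φ ≤ (g φ : EReal) := by
  have : (comap (ket : TestSpace M → ModeSpace M) (𝓝 φ)).NeBot :=
    comap_neBot fun _ ht => denseRange_ket.mem_nhds ht
  have hlim : Tendsto (fun η : TestSpace M => (g (ket η) : EReal)) (comap ket (𝓝 φ))
      (𝓝 (g φ : EReal)) :=
    ((continuous_coe_real_ereal.comp hg).tendsto φ).comp tendsto_comap
  rw [formValue, ← hlim.limsup_eq]
  exact limsup_le_limsup (.of_forall fun η => EReal.coe_le_coe_iff.2 (hW η))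

theorem inner_le_formValue_ket (W : Op M) (η : TestSpace M) :
    ((RCLike.re ⟪ket η, ket (W η)⟫_ℂ : ℝ) : EReal) ≤ formValue W (ket η) := by
  refine le_limsup_of_frequently_le' ?_
  rw [frequently_comap]
  exact frequently_nhds_iff.2 fun U hU _ => ⟨ket η, hU, η, rfl, le_rfl⟩

variable {ι : Type*} (e : HilbertBasis ι ℂ (ModeSpace M)) {v : ModeSpace M}

theorem expectation_le_fidelity_rankOne_self
    (hW : ∀ φ, formValue W φ ≤ ((‖⟪v, φ⟫_ℂ‖ ^ 2 : ℝ) : EReal))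
    {ρ : ModeSpace M →L[ℂ] ModeSpace M} (hρ : ρ.IsPositive) :
    expectation e W ρ ≤ (fidelity e (InnerProductSpace.rankOne ℂ v v) ρ : EReal) := by
  have hpos : ∑' i, (formValue W (opSqrt ρ (e i))).toENNReal ≤
      ENNReal.ofReal (‖opSqrt ρ v‖ ^ 2) := by
    rw [← tsum_ofReal_norm_inner_sq e]
    refine ENNReal.tsum_le_tsum fun i => ?_
    rw [inner_opSqrt_left, ← EReal.real_coe_toENNReal]
    exact EReal.toENNReal_le_toENNReal (hW _)
  calc expectation e W ρ
      ≤ (ENNReal.ofReal (‖opSqrt ρ v‖ ^ 2) : EReal) - 0 :=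
        EReal.sub_le_sub (EReal.coe_ennreal_le_coe_ennreal_iff.2 hpos) (EReal.coe_ennreal_nonneg _)
    _ = (fidelity e (InnerProductSpace.rankOne ℂ v v) ρ : EReal) := by
        rw [sub_zero, EReal.coe_ennreal_ofReal, max_eq_left (sq_nonneg _), norm_opSqrt_apply_sq hρ,
          fidelity_rankOne_self]

theorem expectation_rankOne_self (hv : ‖v‖ = 1)
    (hW : ∀ c : ℂ, formValue W (c • v) = ((‖c‖ ^ 2 : ℝ) : EReal)) :
    expectation e W (InnerProductSpace.rankOne ℂ v v) = 1 := by
  have hform (i : ι) : formValue W (opSqrt (InnerProductSpace.rankOne ℂ v v) (e i)) =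
      ((‖⟪v, e i⟫_ℂ‖ ^ 2 : ℝ) : EReal) := by
    rw [opSqrt_rankOne_self hv, InnerProductSpace.rankOne_apply, hW]
  have hneg (i : ι) : (-((‖⟪v, e i⟫_ℂ‖ ^ 2 : ℝ) : EReal)).toENNReal = 0 :=
    EReal.toENNReal_of_nonpos (EReal.coe_nonpos.2 (neg_nonpos.2 (sq_nonneg _)))
  simp only [expectation, hform, hneg, EReal.real_coe_toENNReal, tsum_zero,
    tsum_ofReal_norm_inner_sq e, hv]
  simp

theorem formValue_smul_ket_of_apply_eq_self {ψ : TestSpace M} (hnorm : ‖ket ψ‖ = 1)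
    (hfix : W ψ = ψ) (hW : ∀ φ, formValue W φ ≤ ((‖⟪ket ψ, φ⟫_ℂ‖ ^ 2 : ℝ) : EReal)) (c : ℂ) :
    formValue W (c • ket ψ) = ((‖c‖ ^ 2 : ℝ) : EReal) := by
  have hket : ket (c • ψ) = c • ket ψ := (ketCLM M).map_smul c ψ
  refine le_antisymm ((hW _).trans_eq ?_) ?_
  · rw [inner_smul_right, inner_self_eq_norm_sq_to_K, hnorm]
    simp
  · have h := inner_le_formValue_ket W (c • ψ)
    rwa [map_smul, hfix, inner_self_eq_norm_sq, hket, norm_smul, hnorm, mul_one] at h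

theorem isFidelityWitness_rankOne_ket {ψ : TestSpace M} (hnorm : ‖ket ψ‖ = 1)
    (hherm : IsHermitianObservable W) (hfix : W ψ = ψ)
    (hle : ∀ η, RCLike.re ⟪ket η, ket (W η)⟫_ℂ ≤ ‖⟪ket ψ, ket η⟫_ℂ‖ ^ 2) :
    IsFidelityWitness e (InnerProductSpace.rankOne ℂ (ket ψ) (ket ψ)) W := by
  have hform : ∀ φ, formValue W φ ≤ ((‖⟪ket ψ, φ⟫_ℂ‖ ^ 2 : ℝ) : EReal) :=
    formValue_le_of_continuous (g := fun φ => ‖⟪ket ψ, φ⟫_ℂ‖ ^ 2) (by fun_prop) hle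
  exact
    { hermitian := hherm
      lower_bound := fun ρ hρ => expectation_le_fidelity_rankOne_self e hform hρ.1
      tight := expectation_rankOne_self e hnorm
        (formValue_smul_ket_of_apply_eq_self hnorm hfix hform) }

end Witness

theorem witness_targetSchwartz (γ : ℝ) {s : ℝ} (hs : 0 < s) (M : ℕ) :
    witness γ s M (targetSchwartz γ hs M) = targetSchwartz γ hs M := by
  rw [witness_eq γ hs.ne']
  simp [sum_apply, lowering_targetSchwartz]

theorem isFidelityWitness_witness (γ : ℝ) {s : ℝ} (hs : 0 < s) {ι : Type*}
    (e : HilbertBasis ι ℂ (ModeSpace M)) :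
    IsFidelityWitness e (target γ hs M) (witness γ s M) := by
  rw [target, ← ket_targetSchwartz]
  refine isFidelityWitness_rankOne_ket e ?_ (isHermitianObservable_witness γ hs.ne' M)
    (witness_targetSchwartz γ hs M) fun η => ?_
  · rw [ket_targetSchwartz, norm_targetVec]
  · rw [ket_targetSchwartz]
    exact re_inner_witness_le γ hs η

end CVWitness

theorem lemma2 (M : ℕ) (γ s : ℝ) (hs : 0 < s)
    {ι : Type*} (e : HilbertBasis ι ℂ (CVWitness.ModeSpace M)) :
    CVWitness.IsDensityOperator e (CVWitness.target γ hs M) ∧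
    CVWitness.IsFidelityWitness e (CVWitness.target γ hs M) (CVWitness.witness γ s M) ∧
    CVWitness.fidelity e (CVWitness.target γ hs M) (CVWitness.target γ hs M) = 1 ∧
    CVWitness.HomodyneMeasurable (6 * M) 4 4 (CVWitness.witness γ s M) := by
  have hnorm := CVWitness.norm_targetVec γ hs M
  exact ⟨CVWitness.isDensityOperator_rankOne_self e hnorm,
    CVWitness.isFidelityWitness_witness γ hs e,
    CVWitness.fidelity_rankOne_self_rankOne_self e hnorm,
    CVWitness.homodyneMeasurable_witness γ s M⟩
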